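/- Let $N\ge 1$, let $\Omega\subset\mathbb{R}^N$ be a bounded open set (in particular, any bounded open set with Lipschitz boundary), let $2\le p<\infty$ and $q=p/(p-1)$. Let $\alpha>0$, $\gamma>0$, let $\xi_1,\xi_2\in L^\infty(\Omega)\cap BV(\Omega)$ with $\alpha\le\xi_1\le\xi_2$ a.e. in $\Omega$, and let $f\in L^2(\Omega)$. Let $\mathbb{S}^N$ be the symmetric $N\times N$ real matrices, and let $\mathfrak{A}_{ad}$ be the set of all $A\in L^\infty(\Omega;\mathbb{S}^N)$ such that, for a.e. $x\in\Omega$ and all $\eta\in\mathbb{R}^N$, $\xi_1(x)^2|\eta|^2\le(\eta,A(x)\eta)\le\xi_2(x)^2|\eta|^2$, and such that $A^{1/2}\in BV(\Omega;\mathbb{S}^N)$ with $\int_\Omega|DA^{1/2}|\le\gamma$, where $\int_\Omega |DS|=\sum_{i\le j}\sup\{\int_\Omega s_{ij}\,\mathrm{div}\,\varphi\,dx:\varphi\in C^1_0(\Omega;\mathbb{R}^N),\ |\varphi|\le1\}$. Let $K:\Omega\times\Omega\to\mathbb{R}$ be measurable with $\int_\Omega\int_\Omega|K(x,t)|^p\,dx\,dt<\infty$,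 and suppose that the operator $B:L^q(\Omega)\to L^p(\Omega)$, $(Bu)(x)=\int_\Omega K(x,t)u(t)\,dt$, is positive: $\int_\Omega (Bu)\,u\,dx\ge0$ for all $u\in L^q(\Omega)$. For each integer $k\ge1$ let $\mathcal{F}_k:\mathbb{R}_+\to\mathbb{R}_+$ be a non-decreasing $C^1$ function with $\mathcal{F}_k(t)=t$ for $0\le t\le k^2$, $\mathcal{F}_k(t)=k^2+1$ for $t>k^2+1$, and, for some $\delta\in(0,1)$, $t\le\mathcal{F}_k(t)\le t+\delta$ for $k^2\le t<k^2+1$. For $\varepsilon>0$ put $$F_{\varepsilon,k}(y,z)=\big[\varepsilon+\mathcal{F}_k(|y|^2)\big]^{\frac{p-2}{2}}y+\big[\varepsilon+\mathcal{F}_k(|z|^2)\big]^{\frac{p-2}{2}}z .$$ For $\varepsilon>0$ and $k\ge1$ let $\Xi_{\varepsilon,k}$ be the set of all triplets $(A,y,z)$ with $A\in\mathfrak{A}_{ad}$, $y\in H^1_0(\Omega)$, $z\in L^2(\Omega)$ such that $$\int_\Omega\big[\varepsilon+\mathcal{F}_k(|A^{1/2}\nabla y|^2)\big]^{\frac{p-2}{2}}(A\nabla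 y,\nabla\varphi)\,dx=\int_\Omega f\varphi\,dx\quad\text{for all }\varphi\in H^1_0(\Omega),$$ $$z+BF_{\varepsilon,k}(y,z)=0\quad\text{a.e. in }\Omega .$$ Then there is a constant $C$ such that for all $\varepsilon>0$, all integers $k\ge1$ and all $(A,y,z)\in\Xi_{\varepsilon,k}$ one has $z\in L^p(\Omega)$ and $\|z\|_{L^p(\Omega)}\le C$. In particular, for every family of admissible triplets $(A_{\varepsilon,k},y_{\varepsilon,k},z_{\varepsilon,k})\in\Xi_{\varepsilon,k}$, the family $\{z_{\varepsilon,k}\}$ is bounded in $L^p(\Omega)$, uniformly in $\varepsilon$ and $k$. -/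

import Mathlib

open MeasureTheory Set Filter Topology
open scoped NNReal ENNReal ContDiff MatrixOrder

noncomputable section

/-- Euclidean space `ℝ^N`. -/
abbrev Euc (N : ℕ) : Type := EuclideanSpace ℝ (Fin N)

/-- The divergence of a vector field. -/
def divergence {N : ℕ} (φ : Euc N → Euc N) (x : Euc N) : ℝ :=
  ∑ i : Fin N, (fderiv ℝ φ x (EuclideanSpace.single i 1)) i

/-- The total variation `∫_Ω |Du|`: the supremum of `∫_Ω u div φ` over all compactly supported
`C¹` vector fields `φ` in `Ω` with `|φ| ≤ 1`. -/
def totalVariation {N : ℕ} (Ω : Set (Euc N)) (u : Euc N → ℝ) : ℝ≥0∞ :=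
  ⨆ φ ∈ {φ : Euc N → Euc N | ContDiff ℝ 1 φ ∧ HasCompactSupport φ ∧ tsupport φ ⊆ Ω ∧
      ∀ x ∈ Ω, ‖φ x‖ ≤ 1},
    ENNReal.ofReal (∫ x in Ω, u x * divergence φ x)

/-- `u ∈ BV(Ω)`. -/
def MemBV {N : ℕ} (Ω : Set (Euc N)) (u : Euc N → ℝ) : Prop :=
  IntegrableOn u Ω ∧ totalVariation Ω u < ⊤

/-- The total variation `∫_Ω |DS|` of a field of symmetric matrices: the sum of the total
variations of the entries `s_{ij}`, `i ≤ j`. -/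
def matrixTotalVariation {N : ℕ} (Ω : Set (Euc N))
    (S : Euc N → Matrix (Fin N) (Fin N) ℝ) : ℝ≥0∞ :=
  ∑ i : Fin N, ∑ j ∈ Finset.Ici i, totalVariation Ω (fun x => S x i j)

/-- The principal square root `A(x)^{1/2}` of a field of positive semidefinite matrices. -/
def sqrtField {N : ℕ} (A : Euc N → Matrix (Fin N) (Fin N) ℝ) :
    Euc N → Matrix (Fin N) (Fin N) ℝ :=
  fun x => CFC.sqrt (A x)

/-- Multiplication of a vector of Euclidean space by a matrix. -/
def matVec {N : ℕ} (M : Matrix (Fin N) (Fin N) ℝ) (v : Euc N) : Euc N :=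
  Matrix.toEuclideanLin M v

/-- The class of admissible controls: `A ∈ L^∞(Ω; 𝕊^N)` with
`ξ₁² |η|² ≤ (η, A η) ≤ ξ₂² |η|²` a.e., `A^{1/2} ∈ BV(Ω; 𝕊^N)` and `∫_Ω |D A^{1/2}| ≤ γ`. -/
structure IsAdmissibleControl {N : ℕ} (Ω : Set (Euc N)) (ξ₁ ξ₂ : Euc N → ℝ) (γ : ℝ)
    (A : Euc N → Matrix (Fin N) (Fin N) ℝ) : Prop where
  memLp_top : ∀ i j, MemLp (fun x => A x i j) ⊤ (volume.restrict Ω)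
  symm : ∀ᵐ x ∂(volume.restrict Ω), (A x).IsSymm
  bounds : ∀ᵐ x ∂(volume.restrict Ω), ∀ η : Euc N,
    ξ₁ x ^ 2 * ‖η‖ ^ 2 ≤ inner ℝ η (matVec (A x) η) ∧
      inner ℝ η (matVec (A x) η) ≤ ξ₂ x ^ 2 * ‖η‖ ^ 2
  sqrt_memBV : ∀ i j, MemBV Ω (fun x => sqrtField A x i j)
  sqrt_variation : matrixTotalVariation Ω (sqrtField A) ≤ ENNReal.ofReal γ

/-- `y ∈ H¹₀(Ω)` with weak gradient `g`: the pair `(y, g)` is the limit in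
`L²(Ω) × L²(Ω; ℝ^N)` of pairs `(φ n, ∇ φ n)` with `φ n ∈ C_c^∞(Ω)`. -/
structure HasH10Gradient {N : ℕ} (Ω : Set (Euc N)) (y : Euc N → ℝ) (g : Euc N → Euc N) :
    Prop where
  memLp : MemLp y 2 (volume.restrict Ω)
  memLp_gradient : MemLp g 2 (volume.restrict Ω)
  approx : ∃ φ : ℕ → Euc N → ℝ,
    (∀ n, ContDiff ℝ ∞ (φ n) ∧ HasCompactSupport (φ n) ∧ tsupport (φ n) ⊆ Ω) ∧
    Tendsto (fun n => eLpNorm (fun x => φ n x - y x) 2 (volume.restrict Ω)) atTop (𝓝 0) ∧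
    Tendsto (fun n => eLpNorm (fun x => gradient (φ n) x - g x) 2 (volume.restrict Ω))
      atTop (𝓝 0)

/-- The conditions on the cut-off function `𝓕_k : ℝ₊ → ℝ₊`. Only the values on `[0, ∞)` matter;
that they are nonnegative follows from `𝓕_k 0 = 0` and monotonicity. -/
structure IsCutoff (k : ℕ) (Φ : ℝ → ℝ) : Prop where
  contDiffOn : ContDiffOn ℝ 1 Φ (Ici 0)
  monotoneOn : MonotoneOn Φ (Ici 0)
  eq_self : ∀ t ∈ Icc (0 : ℝ) ((k : ℝ) ^ 2), Φ t = t
  eq_const : ∀ t : ℝ, (k : ℝ) ^ 2 + 1 < t → Φ t = (k : ℝ) ^ 2 + 1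
  between : ∃ δ ∈ Ioo (0 : ℝ) 1, ∀ t ∈ Ico ((k : ℝ) ^ 2) ((k : ℝ) ^ 2 + 1),
    t ≤ Φ t ∧ Φ t ≤ t + δ

/-- The integral operator `(B u)(x) = ∫_Ω K(x, t) u(t) dt`. -/
def kernelOp {N : ℕ} (Ω : Set (Euc N)) (K : Euc N → Euc N → ℝ) (u : Euc N → ℝ) (x : Euc N) : ℝ :=
  ∫ t in Ω, K x t * u t

/-- The scalar nonlinearity `[ε + Φ(s²)]^{(p-2)/2}`. -/
def regWeight (p ε : ℝ) (Φ : ℝ → ℝ) (s : ℝ) : ℝ :=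
  (ε + Φ (s ^ 2)) ^ ((p - 2) / 2)

/-- `F_{ε,k}(y, z) = [ε + 𝓕_k(|y|²)]^{(p-2)/2} y + [ε + 𝓕_k(|z|²)]^{(p-2)/2} z`, with `Φ = 𝓕_k`. -/
def hammersteinF {N : ℕ} (p ε : ℝ) (Φ : ℝ → ℝ) (y z : Euc N → ℝ) (x : Euc N) : ℝ :=
  regWeight p ε Φ |y x| * y x + regWeight p ε Φ |z x| * z x

/-- `y ∈ H¹₀(Ω)` is a weak solution of
`-div([ε + Φ(|A^{1/2} ∇y|²)]^{(p-2)/2} A ∇y) = f` in `Ω`, as an identity in `H^{-1}(Ω)`. -/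
def IsRegularizedWeakSolution {N : ℕ} (Ω : Set (Euc N)) (p ε : ℝ) (Φ : ℝ → ℝ) (f : Euc N → ℝ)
    (A : Euc N → Matrix (Fin N) (Fin N) ℝ) (y : Euc N → ℝ) : Prop :=
  ∃ g : Euc N → Euc N, HasH10Gradient Ω y g ∧
    ∀ (φ : Euc N → ℝ) (gφ : Euc N → Euc N), HasH10Gradient Ω φ gφ →
      ∫ x in Ω, regWeight p ε Φ ‖matVec (sqrtField A x) (g x)‖ *
          inner ℝ (matVec (A x) (g x)) (gφ x)
        = ∫ x in Ω, f x * φ x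

/-- `(A, y, z) ∈ Ξ_{ε,k}`, with `Φ = 𝓕_k`: `A` is an admissible control, `y ∈ H¹₀(Ω)` solves the
regularized boundary value problem for `A`, and `z ∈ L²(Ω)` solves the regularized Hammerstein
equation `z + B F_{ε,k}(y, z) = 0` in `Ω`. -/
structure IsAdmissibleTriplet {N : ℕ} (Ω : Set (Euc N)) (p : ℝ) (ξ₁ ξ₂ : Euc N → ℝ) (γ : ℝ)
    (f : Euc N → ℝ) (K : Euc N → Euc N → ℝ) (ε : ℝ) (Φ : ℝ → ℝ)
    (A : Euc N → Matrix (Fin N) (Fin N) ℝ) (y z : Euc N → ℝ) : Prop where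
  control : IsAdmissibleControl Ω ξ₁ ξ₂ γ A
  state : IsRegularizedWeakSolution Ω p ε Φ f A y
  memLp : MemLp z 2 (volume.restrict Ω)
  hammerstein : ∀ᵐ x ∂(volume.restrict Ω), z x + kernelOp Ω K (hammersteinF p ε Φ y z) x = 0

end

/-! Write `h(u) = [ε + Φ(u)]^{(p-2)/2}`. Everything is measured by the modular `∫ h(|v|²)|v|²`,
which mimics `∫ |v|^p` and has doubling constants independent of `ε` and `k`, because a cut-off
satisfies `min(u, k²) ≤ Φ(u) ≤ 2 min(u, k²)`.

Testing the state equation with `y` turns the modular of `A^{1/2}∇y` into `∫ f y`. The ordinary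
Poincaré inequality (weight `1`) then bounds it, even after multiplication by `1 + ε^{(p-2)/2}`;
this factor is what gives uniformity for large `ε`. Ellipticity and doubling pass from `A^{1/2}∇y`
to `∇y`, and a modular Poincaré inequality (`integral_mul_sq_le_gradient`) passes to `y`; this is
`exists_energy_bound`.

Positivity of `B` together with `z = -BF` gives `∫ z F ≤ 0`, so the modular of `z` is at most four
times that of `y` (`integral_mul_sq_le_of_integral_mul_nonpos`). The growth bound
`rpow_cutoffWeight_mul_le` converts modular bounds into a bound for `F` in `L^q`. Since the kernel
lies in `L^p(Ω × Ω)`, Hölder's inequality bounds `z = -BF` in `L^p`. -/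

/-! ### Doubling weights, their primitives and pointwise inequalities -/

/-- A bounded continuous weight, monotone on `[0, ∞)`, with `h (l u) ≤ D l * h u` for `l ≥ 1`. -/
structure IsDoublingWeight (D h : ℝ → ℝ) : Prop where
  continuous : Continuous h
  nonneg : ∀ u, 0 ≤ h u
  bounded : ∃ M, ∀ u, h u ≤ M
  monotoneOn : MonotoneOn h (Ici 0)
  doubling : ∀ l u, 1 ≤ l → 0 ≤ u → h (l * u) ≤ D l * h u

namespace IsDoublingWeight

variable {D h : ℝ → ℝ}

lemma const_one : IsDoublingWeight (fun _ => 1) (fun _ => 1) where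
  continuous := continuous_const
  nonneg _ := zero_le_one
  bounded := ⟨1, fun _ => le_rfl⟩
  monotoneOn := monotoneOn_const
  doubling _ _ _ _ := by simp

lemma hasDerivAt_primitive (hh : IsDoublingWeight D h) (u : ℝ) :
    HasDerivAt (fun u => ∫ v in (0 : ℝ)..u, h v) (h u) u :=
  (hh.continuous.integral_hasStrictDerivAt 0 u).hasDerivAt

lemma continuous_primitive (hh : IsDoublingWeight D h) :
    Continuous (fun u => ∫ v in (0 : ℝ)..u, h v) :=
  continuous_iff_continuousAt.2 fun u => (hh.hasDerivAt_primitive u).continuousAt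

lemma primitive_le (hh : IsDoublingWeight D h) {u : ℝ} (hu : 0 ≤ u) :
    ∫ v in (0 : ℝ)..u, h v ≤ h u * u := by
  have := intervalIntegral.integral_mono_on (μ := volume) hu
    (hh.continuous.intervalIntegrable 0 u)
    (continuous_const.intervalIntegrable 0 u)
    (g := fun _ => h u) fun v hv => hh.monotoneOn hv.1 hu hv.2
  simpa [mul_comm] using this

lemma primitive_nonneg (hh : IsDoublingWeight D h) {u : ℝ} (hu : 0 ≤ u) :
    0 ≤ ∫ v in (0 : ℝ)..u, h v :=
  intervalIntegral.integral_nonneg hu fun v _ => hh.nonneg v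

/-- The upper half `[u/2, u]` already contributes `h(u/2) u/2`, and doubling compares `h(u/2)` with
`h(u)`. With `primitive_le`, this makes the primitive `G(u)` interchangeable with `h(u) u`. Unlike
`h(u) u`, `G` is differentiable without differentiating the weight, and it is Lipschitz. -/
lemma le_primitive (hh : IsDoublingWeight D h) (hD : ∀ l, 1 ≤ D l) {u : ℝ} (hu : 0 ≤ u) :
    h u * u ≤ 2 * D 2 * ∫ v in (0 : ℝ)..u, h v := by
  have hu2 : 0 ≤ u / 2 := by positivity
  have h1 : h (u / 2) * (u / 2) ≤ ∫ v in (u / 2)..u, h v := by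
    have := intervalIntegral.integral_mono_on (μ := volume) (half_le_self hu)
      (continuous_const.intervalIntegrable (u / 2) u)
      (hh.continuous.intervalIntegrable (u / 2) u)
      (f := fun _ => h (u / 2))
      fun v hv => hh.monotoneOn hu2 (hu2.trans hv.1) hv.1
    simp only [intervalIntegral.integral_const, smul_eq_mul] at this
    linarith
  have h2 := intervalIntegral.integral_add_adjacent_intervals
    (hh.continuous.intervalIntegrable (μ := volume) 0 (u / 2))
    (hh.continuous.intervalIntegrable (μ := volume) (u / 2) u)
  have h3 := hh.primitive_nonneg hu2
  have h4 : h u ≤ D 2 * h (u / 2) := by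
    have := hh.doubling 2 (u / 2) one_le_two hu2
    rwa [mul_div_cancel₀ u two_ne_zero] at this
  have hD2 := hD 2
  calc h u * u ≤ D 2 * h (u / 2) * u := by gcongr
    _ = 2 * D 2 * (h (u / 2) * (u / 2)) := by ring
    _ ≤ 2 * D 2 * ∫ v in (0 : ℝ)..u, h v := by gcongr; linarith

lemma abs_primitive_sub_le (hh : IsDoublingWeight D h) {M : ℝ} (hM : ∀ u, h u ≤ M) (a b : ℝ) :
    |(∫ v in (0 : ℝ)..a, h v) - ∫ v in (0 : ℝ)..b, h v| ≤ M * |a - b| := by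
  rw [intervalIntegral.integral_interval_sub_left (hh.continuous.intervalIntegrable _ _)
    (hh.continuous.intervalIntegrable _ _)]
  exact intervalIntegral.norm_integral_le_of_norm_le_const fun v _ => by
    rw [Real.norm_of_nonneg (hh.nonneg v)]; exact hM v

/-- A Young type inequality for the weight. -/
lemma mul_mul_le (hh : IsDoublingWeight D h) (hD : ∀ l, 1 ≤ D l) {η a b : ℝ} (hη : 0 < η)
    (hη1 : η ≤ 1) (ha : 0 ≤ a) (hb : 0 ≤ b) :
    h (a ^ 2) * a * b ≤ η * (h (a ^ 2) * a ^ 2) + D (1 / η ^ 2) / η * (h (b ^ 2) * b ^ 2) := by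
  have hDp : 0 ≤ D (1 / η ^ 2) := zero_le_one.trans (hD _)
  have ha2 := hh.nonneg (a ^ 2)
  have hb2 := hh.nonneg (b ^ 2)
  -- Either `b` is small and the first term absorbs the product, or `a ≤ b/η` and monotonicity with
  -- doubling moves the weight from `a²` to `b²`.
  rcases le_or_gt b (η * a) with hab | hab
  · have : h (a ^ 2) * a * b ≤ h (a ^ 2) * a * (η * a) := by gcongr
    have : 0 ≤ D (1 / η ^ 2) / η * (h (b ^ 2) * b ^ 2) := by positivity
    linarith
  · have hle : a ≤ b / η := by rw [le_div_iff₀ hη]; linarith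
    have h1 : h (a ^ 2) ≤ D (1 / η ^ 2) * h (b ^ 2) := by
      refine le_trans (hh.monotoneOn (sq_nonneg a) ?_ (?_ : a ^ 2 ≤ 1 / η ^ 2 * b ^ 2))
        (hh.doubling _ _ ?_ (sq_nonneg b))
      · exact mem_Ici.2 (by positivity)
      · calc a ^ 2 ≤ (b / η) ^ 2 := by gcongr
          _ = _ := by field_simp
      · rw [le_div_iff₀ (by positivity), one_mul]; exact pow_le_one₀ hη.le hη1
    have : 0 ≤ η * (h (a ^ 2) * a ^ 2) := by positivity
    calc h (a ^ 2) * a * b ≤ D (1 / η ^ 2) * h (b ^ 2) * (b / η) * b := by gcongr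
      _ = D (1 / η ^ 2) / η * (h (b ^ 2) * b ^ 2) := by field_simp
      _ ≤ _ := by linarith

/-- The case of the Young type inequality in which no doubling is needed. -/
lemma mul_mul_le_half (hh : IsDoublingWeight D h) {a b : ℝ} (ha : 0 ≤ a) (hb : 0 ≤ b) :
    h (a ^ 2) * a * b ≤ 2 * (h (a ^ 2) * a ^ 2) + 1 / 2 * (h (b ^ 2) * b ^ 2) := by
  have ha2 := hh.nonneg (a ^ 2)
  have hb2 := hh.nonneg (b ^ 2)
  have : 0 ≤ h (a ^ 2) * a ^ 2 := by positivity
  have : 0 ≤ h (b ^ 2) * b ^ 2 := by positivity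
  rcases le_or_gt b (2 * a) with hab | hab
  · have : h (a ^ 2) * a * b ≤ h (a ^ 2) * a * (2 * a) := by gcongr
    linarith
  · have h1 : h (a ^ 2) ≤ h (b ^ 2) := hh.monotoneOn (sq_nonneg a) (sq_nonneg b)
      (by gcongr; linarith)
    have : h (a ^ 2) * a * b ≤ h (b ^ 2) * (b / 2) * b := by gcongr; linarith
    linarith

/-! ### Modular integrals of square integrable functions -/

section Integral

variable {X E : Type*} [MeasurableSpace X] {μ : Measure X} [NormedAddCommGroup E]

/-- The upper bound of the weight is used only qualitatively, for integrability and limits; for the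
cut-off weights it depends on `ε` and `k` and must not enter the final constant. -/
lemma integrable_mul_sq (hh : IsDoublingWeight D h) {g : X → E} (hg : MemLp g 2 μ) :
    Integrable (fun x => h (‖g x‖ ^ 2) * ‖g x‖ ^ 2) μ := by
  obtain ⟨M, hM⟩ := hh.bounded
  refine (hg.integrable_norm_pow two_ne_zero).bdd_mul (c := M) ?_ (ae_of_all _ fun x => ?_)
  · exact hh.continuous.comp_aestronglyMeasurable (hg.1.norm.pow 2)
  · rw [Real.norm_of_nonneg (hh.nonneg _)]; exact hM _

lemma integral_mul_sq_nonneg (hh : IsDoublingWeight D h) (g : X → E) :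
    0 ≤ ∫ x, h (‖g x‖ ^ 2) * ‖g x‖ ^ 2 ∂μ :=
  integral_nonneg fun _ => mul_nonneg (hh.nonneg _) (sq_nonneg _)

lemma integrable_primitive (hh : IsDoublingWeight D h) {g : X → E} (hg : MemLp g 2 μ) :
    Integrable (fun x => ∫ v in (0 : ℝ)..(‖g x‖ ^ 2), h v) μ := by
  refine (hh.integrable_mul_sq hg).mono'
    (hh.continuous_primitive.comp_aestronglyMeasurable (hg.1.norm.pow 2)) (ae_of_all _ fun x => ?_)
  rw [Real.norm_of_nonneg (hh.primitive_nonneg (sq_nonneg _))]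
  exact hh.primitive_le (sq_nonneg _)

lemma integral_primitive_le (hh : IsDoublingWeight D h) {g : X → E} (hg : MemLp g 2 μ) :
    ∫ x, (∫ v in (0 : ℝ)..(‖g x‖ ^ 2), h v) ∂μ ≤ ∫ x, h (‖g x‖ ^ 2) * ‖g x‖ ^ 2 ∂μ :=
  integral_mono (hh.integrable_primitive hg) (hh.integrable_mul_sq hg)
    fun _ => hh.primitive_le (sq_nonneg _)

lemma integral_mul_sq_le (hh : IsDoublingWeight D h) (hD : ∀ l, 1 ≤ D l) {g : X → E}
    (hg : MemLp g 2 μ) :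
    ∫ x, h (‖g x‖ ^ 2) * ‖g x‖ ^ 2 ∂μ
      ≤ 2 * D 2 * ∫ x, (∫ v in (0 : ℝ)..(‖g x‖ ^ 2), h v) ∂μ := by
  rw [← integral_const_mul]
  exact integral_mono (hh.integrable_mul_sq hg) ((hh.integrable_primitive hg).const_mul _)
    fun _ => hh.le_primitive hD (sq_nonneg _)

/-- The primitive is `M`-Lipschitz, so the integrands differ by at most `M |G n - g| (|G n - g| +
2|g|)`, which tends to zero in `L¹` by Hölder's inequality. This carries the Poincaré inequality
from test functions to `H¹₀`. -/
lemma tendsto_integral_primitive (hh : IsDoublingWeight D h) {g : X → E} {G : ℕ → X → E}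
    (hg : MemLp g 2 μ) (hG : ∀ n, AEStronglyMeasurable (G n) μ)
    (hlim : Tendsto (fun n => eLpNorm (fun x => G n x - g x) 2 μ) atTop (𝓝 0)) :
    Tendsto (fun n => ∫ x, (∫ v in (0 : ℝ)..(‖G n x‖ ^ 2), h v) ∂μ) atTop
      (𝓝 (∫ x, (∫ v in (0 : ℝ)..(‖g x‖ ^ 2), h v) ∂μ)) := by
  obtain ⟨M, hM⟩ := hh.bounded
  have hM0 : 0 ≤ M := (hh.nonneg 0).trans (hM 0)
  have hfin : ∀ᶠ n in atTop, MemLp (G n) 2 μ := by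
    filter_upwards [hlim.eventually (gt_mem_nhds ENNReal.zero_lt_top)] with n hn
    have : MemLp (fun x => G n x - g x) 2 μ := ⟨(hG n).sub hg.1, hn⟩
    exact (this.add hg).ae_eq (ae_of_all _ fun x => by simp)
  refine tendsto_integral_of_L1' _ (hh.integrable_primitive hg).1
    (hfin.mono fun n hn => hh.integrable_primitive hn) ?_
  have hbound : ∀ᶠ n in atTop,
      eLpNorm ((fun x => ∫ v in (0 : ℝ)..(‖G n x‖ ^ 2), h v)
        - fun x => ∫ v in (0 : ℝ)..(‖g x‖ ^ 2), h v) 1 μ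
      ≤ ENNReal.ofReal M * (eLpNorm (fun x => G n x - g x) 2 μ *
        (eLpNorm (fun x => G n x - g x) 2 μ + (eLpNorm g 2 μ + eLpNorm g 2 μ))) := by
    filter_upwards [hfin] with n hn
    have hd : AEStronglyMeasurable (fun x => ‖G n x - g x‖) μ := (hn.1.sub hg.1).norm
    have hs : AEStronglyMeasurable (fun x => ‖G n x - g x‖ + (‖g x‖ + ‖g x‖)) μ :=
      hd.add (hg.1.norm.add hg.1.norm)
    calc _ ≤ ENNReal.ofReal M * eLpNorm ((fun x => ‖G n x - g x‖) •
              fun x => ‖G n x - g x‖ + (‖g x‖ + ‖g x‖)) 1 μ := by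
          refine eLpNorm_le_mul_eLpNorm_of_ae_le_mul (ae_of_all _ fun x => ?_) 1
          simp only [Pi.sub_apply, Pi.smul_apply', smul_eq_mul]
          refine (hh.abs_primitive_sub_le hM _ _).trans ?_
          gcongr
          have h1 : |‖G n x‖ - ‖g x‖| ≤ ‖G n x - g x‖ := abs_norm_sub_norm_le _ _
          have h2 : ‖G n x‖ ≤ ‖G n x - g x‖ + ‖g x‖ := by
            simpa using norm_add_le (G n x - g x) (g x)
          rw [sq_sub_sq, abs_mul, mul_comm, norm_mul, norm_norm,
            Real.norm_of_nonneg (by positivity : 0 ≤ ‖G n x - g x‖ + (‖g x‖ + ‖g x‖)),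
            abs_of_nonneg (by positivity : 0 ≤ ‖G n x‖ + ‖g x‖)]
          exact mul_le_mul h1 (by linarith) (by positivity) (by positivity)
      _ ≤ ENNReal.ofReal M * (eLpNorm (fun x => ‖G n x - g x‖) 2 μ *
            eLpNorm (fun x => ‖G n x - g x‖ + (‖g x‖ + ‖g x‖)) 2 μ) := by
          gcongr
          exact eLpNorm_smul_le_mul_eLpNorm hs hd
      _ ≤ _ := by
          rw [eLpNorm_norm (fun x => G n x - g x)]
          gcongr
          refine (eLpNorm_add_le hd (hg.1.norm.add hg.1.norm) one_le_two).trans ?_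
          rw [eLpNorm_norm (fun x => G n x - g x)]
          gcongr
          refine (eLpNorm_add_le hg.1.norm hg.1.norm one_le_two).trans ?_
          rw [eLpNorm_norm]
  refine tendsto_of_tendsto_of_tendsto_of_le_of_le' tendsto_const_nhds ?_
    (Eventually.of_forall fun _ => zero_le) hbound
  have h2 : eLpNorm g 2 μ + eLpNorm g 2 μ ≠ ⊤ := ENNReal.add_ne_top.2 ⟨hg.2.ne, hg.2.ne⟩
  have := ENNReal.Tendsto.const_mul (a := ENNReal.ofReal M)
    (ENNReal.Tendsto.mul hlim (Or.inr (by simpa using h2))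
    (hlim.add_const (eLpNorm g 2 μ + eLpNorm g 2 μ)) (Or.inr ENNReal.zero_ne_top))
    (Or.inr ENNReal.ofReal_ne_top)
  simpa using this

end Integral

end IsDoublingWeight

/-! ### The modular Poincaré inequality -/

namespace IsDoublingWeight

variable {N : ℕ} {D h : ℝ → ℝ}

/-- Integration by parts of `∂ᵢ (xᵢ G(φ²))`, where `G` is the primitive of the weight. -/
lemma integral_primitive_sq_eq (hh : IsDoublingWeight D h) (i : Fin N) {φ : Euc N → ℝ}
    (hφ : ContDiff ℝ 1 φ) (hc : HasCompactSupport φ) :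
    ∫ x, (∫ v in (0 : ℝ)..(φ x ^ 2), h v)
      = - ∫ x, x i * (h (φ x ^ 2) * (2 * φ x * fderiv ℝ φ x (EuclideanSpace.single i 1))) := by
  set e : Euc N := EuclideanSpace.single i 1
  set P : Euc N → ℝ := fun x => ∫ v in (0 : ℝ)..(φ x ^ 2), h v with hP
  set L : Euc N →L[ℝ] ℝ := EuclideanSpace.proj i with hL
  have hdφ : ∀ x, HasFDerivAt φ (fderiv ℝ φ x) x := fun x =>
    (hφ.differentiable one_ne_zero x).hasFDerivAt
  have hPd : ∀ x, HasFDerivAt P (h (φ x ^ 2) • ((2 * φ x) • fderiv ℝ φ x)) x := fun x => by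
    have h1 : HasFDerivAt (fun x => φ x ^ 2) ((2 * φ x) • fderiv ℝ φ x) x := by
      simpa using (hdφ x).pow 2
    exact (hh.hasDerivAt_primitive (φ x ^ 2)).comp_hasFDerivAt x h1
  have hPfd : ∀ x, fderiv ℝ P x e = h (φ x ^ 2) * (2 * φ x * fderiv ℝ φ x e) := fun x => by
    rw [(hPd x).fderiv]; simp
  have hLfd : ∀ x, fderiv ℝ (fun y : Euc N => L y) x e = 1 := fun x => by
    rw [L.hasFDerivAt.fderiv]; simp [hL, e]
  have hPc : Continuous P := continuous_iff_continuousAt.2 fun x => (hPd x).continuousAt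
  have hPs : HasCompactSupport P := hc.mono fun x hx hx0 => hx (by simp [hP, hx0])
  have hQc : Continuous fun x => fderiv ℝ φ x e :=
    (hφ.continuous_fderiv one_ne_zero).clm_apply continuous_const
  have hφc := hφ.continuous
  have hhc := hh.continuous
  have key := integral_mul_fderiv_eq_neg_fderiv_mul_of_integrable (μ := volume)
    (f := fun x : Euc N => L x) (g := P) (v := e)
    (by simpa only [hLfd, one_mul] using hPc.integrable_of_hasCompactSupport hPs)
    (by
      simp only [hPfd]
      refine Continuous.integrable_of_hasCompactSupport (by fun_prop) ?_
      exact hc.mono fun x hx hx0 => hx (by simp [hx0]))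
    ((L.continuous.mul hPc).integrable_of_hasCompactSupport hPs.mul_left)
    (fun x _ => L.differentiableAt) (fun x _ => (hPd x).differentiableAt)
  simp only [hLfd, hPfd, one_mul] at key
  rw [eq_neg_iff_add_eq_zero, add_comm, ← eq_neg_iff_add_eq_zero]
  exact key

/-- The modular Poincaré inequality for test functions. -/
lemma integral_primitive_sq_le (hh : IsDoublingWeight D h) (hD : ∀ l, 1 ≤ D l) (i : Fin N)
    {R : ℝ} (hR : 1 ≤ R) {φ : Euc N → ℝ}
    (hφ : ContDiff ℝ 1 φ) (hc : HasCompactSupport φ) (hs : tsupport φ ⊆ Metric.closedBall 0 R) :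
    ∫ x, (∫ v in (0 : ℝ)..(φ x ^ 2), h v)
      ≤ 32 * R ^ 2 * D 2 * D ((8 * R * D 2) ^ 2) *
        ∫ x, h (‖gradient φ x‖ ^ 2) * ‖gradient φ x‖ ^ 2 := by
  have hD2 := hD 2
  have hdc : Continuous (gradient φ) :=
    (InnerProductSpace.toDual ℝ (Euc N)).symm.continuous.comp (hφ.continuous_fderiv one_ne_zero)
  have hds : HasCompactSupport (gradient φ) :=
    (hc.fderiv (𝕜 := ℝ)).comp_left (map_zero _)
  have hφ2 : MemLp φ 2 volume := hφ.continuous.memLp_of_hasCompactSupport hc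
  have hd2 : MemLp (gradient φ) 2 volume := hdc.memLp_of_hasCompactSupport hds
  have hi1 := hh.integrable_mul_sq hφ2
  have hi2 := hh.integrable_mul_sq hd2
  have hle := hh.integral_mul_sq_le hD hφ2
  simp only [Real.norm_eq_abs, sq_abs] at hi1 hle
  -- Chosen so that `2R · η · 2 D(2) = 1/2`: the term in `φ` is then absorbed by the left-hand side.
  set η : ℝ := 1 / (8 * R * D 2) with hη
  have hη0 : 0 < η := by positivity
  have hη1 : η ≤ 1 := by
    rw [hη, div_le_one (by positivity)]; nlinarith
  have hpt : ∀ x, -(x i * (h (φ x ^ 2) * (2 * φ x *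
      fderiv ℝ φ x (EuclideanSpace.single i 1)))) ≤
      2 * R * (η * (h (φ x ^ 2) * φ x ^ 2) +
        D (1 / η ^ 2) / η * (h (‖gradient φ x‖ ^ 2) * ‖gradient φ x‖ ^ 2)) := fun x => by
    have hy := hh.mul_mul_le hD hη0 hη1 (abs_nonneg (φ x)) (norm_nonneg (gradient φ x))
    rw [sq_abs] at hy
    -- The bound `|x i| ≤ R` is available only on the support of `φ`; where `φ` vanishes the
    -- left-hand side is zero.
    by_cases hx : φ x = 0
    · have h0 := hh.nonneg (φ x ^ 2)
      rw [hx] at hy ⊢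
      simp only [abs_zero, mul_zero, zero_mul, neg_zero] at hy ⊢
      nlinarith
    have hxR : |x i| ≤ R := by
      have := hs (subset_tsupport φ hx)
      rw [mem_closedBall_zero_iff] at this
      exact (PiLp.norm_apply_le x i).trans this
    have hder : |fderiv ℝ φ x (EuclideanSpace.single i 1)| ≤ ‖gradient φ x‖ := by
      rw [← inner_gradient_left]
      refine (abs_real_inner_le_norm _ _).trans ?_
      simp
    calc _ ≤ |x i * (h (φ x ^ 2) * (2 * φ x *
            fderiv ℝ φ x (EuclideanSpace.single i 1)))| := neg_le_abs _
      _ = |x i| * (h (φ x ^ 2) * (2 * |φ x| *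
            |fderiv ℝ φ x (EuclideanSpace.single i 1)|)) := by
          simp only [abs_mul, abs_of_nonneg (hh.nonneg _), abs_two]
      _ ≤ R * (h (φ x ^ 2) * (2 * |φ x| * ‖gradient φ x‖)) := by
          have := hh.nonneg (φ x ^ 2)
          gcongr
      _ = 2 * R * (h (φ x ^ 2) * |φ x| * ‖gradient φ x‖) := by ring
      _ ≤ _ := by gcongr
  have hle2 : ∫ x, (∫ v in (0 : ℝ)..(φ x ^ 2), h v) ≤
      2 * R * (η * ∫ x, h (φ x ^ 2) * φ x ^ 2) +
        2 * R * (D (1 / η ^ 2) / η * ∫ x, h (‖gradient φ x‖ ^ 2) * ‖gradient φ x‖ ^ 2) := by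
    rw [hh.integral_primitive_sq_eq i hφ hc, ← integral_neg, ← mul_add, ← integral_const_mul,
      ← integral_const_mul, ← integral_add (hi1.const_mul _) (hi2.const_mul _),
      ← integral_const_mul]
    refine integral_mono ?_ (((hi1.const_mul _).add (hi2.const_mul _)).const_mul _) hpt
    have hQc : Continuous fun x => fderiv ℝ φ x (EuclideanSpace.single i 1) :=
      (hφ.continuous_fderiv one_ne_zero).clm_apply continuous_const
    have hφc := hφ.continuous
    have hhc := hh.continuous
    refine (Continuous.integrable_of_hasCompactSupport (by fun_prop) ?_).neg
    exact hc.mono fun x hx hx0 => hx (by simp [hx0])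
  have hη2 : 1 / η ^ 2 = (8 * R * D 2) ^ 2 := by rw [hη]; field_simp
  have hab : 2 * R * (η * ∫ x, h (φ x ^ 2) * φ x ^ 2) ≤
      1 / 2 * ∫ x, (∫ v in (0 : ℝ)..(φ x ^ 2), h v) := by
    calc _ ≤ 2 * R * (η * (2 * D 2 * ∫ x, (∫ v in (0 : ℝ)..(φ x ^ 2), h v))) := by gcongr
      _ = _ := by rw [hη]; field_simp; ring
  rw [hη2] at hle2
  set Z := ∫ x, h (‖gradient φ x‖ ^ 2) * ‖gradient φ x‖ ^ 2
  have hcd : 2 * R * (D ((8 * R * D 2) ^ 2) / η * Z) =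
      1 / 2 * (32 * R ^ 2 * D 2 * D ((8 * R * D 2) ^ 2) * Z) := by
    rw [hη]; field_simp; ring
  linarith

/-- The modular Poincaré inequality in `H¹₀(Ω)`. -/
theorem integral_mul_sq_le_gradient (hh : IsDoublingWeight D h) (hD : ∀ l, 1 ≤ D l) (i : Fin N)
    {R : ℝ} (hR : 1 ≤ R) {Ω : Set (Euc N)}
    (hs : Ω ⊆ Metric.closedBall 0 R) {y : Euc N → ℝ}
    {g : Euc N → Euc N} (hy : HasH10Gradient Ω y g) :
    ∫ x in Ω, h (|y x| ^ 2) * |y x| ^ 2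
      ≤ 128 * R ^ 2 * D 2 ^ 3 * D ((8 * R * D 2) ^ 2) *
        ∫ x in Ω, h (‖g x‖ ^ 2) * ‖g x‖ ^ 2 := by
  obtain ⟨φ, hφ, hlim, hlimg⟩ := hy.approx
  have hφ1 : ∀ n, ContDiff ℝ 1 (φ n) := fun n => (hφ n).1.of_le (by simp)
  have hD2 := hD 2
  have hDR := hD ((8 * R * D 2) ^ 2)
  have hdc : ∀ n, Continuous (gradient (φ n)) := fun n =>
    (InnerProductSpace.toDual ℝ (Euc N)).symm.continuous.comp
      ((hφ1 n).continuous_fderiv one_ne_zero)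
  have hd2 : ∀ n, MemLp (gradient (φ n)) 2 (volume.restrict Ω) := fun n =>
    ((hdc n).memLp_of_hasCompactSupport
      (((hφ n).2.1.fderiv (𝕜 := ℝ)).comp_left (map_zero _))).restrict Ω
  have t1 := hh.tendsto_integral_primitive hy.memLp
    (fun n => (hφ1 n).continuous.aestronglyMeasurable) hlim
  have t2 := hh.tendsto_integral_primitive hy.memLp_gradient
    (fun n => (hdc n).aestronglyMeasurable) hlimg
  have hle : ∀ n, ∫ x in Ω, (∫ v in (0 : ℝ)..(‖φ n x‖ ^ 2), h v) ≤
      64 * R ^ 2 * D 2 ^ 2 * D ((8 * R * D 2) ^ 2) *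
        ∫ x in Ω, (∫ v in (0 : ℝ)..(‖gradient (φ n) x‖ ^ 2), h v) := fun n => by
    have h1 := hh.integral_primitive_sq_le hD i hR (hφ1 n) (hφ n).2.1 ((hφ n).2.2.trans hs)
    have h2 := hh.integral_mul_sq_le hD (hd2 n)
    have e1 : ∫ x in Ω, (∫ v in (0 : ℝ)..(‖φ n x‖ ^ 2), h v) =
        ∫ x, (∫ v in (0 : ℝ)..(φ n x ^ 2), h v) := by
      simp only [Real.norm_eq_abs, sq_abs]
      refine setIntegral_eq_integral_of_forall_compl_eq_zero fun x hx => ?_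
      rw [image_eq_zero_of_notMem_tsupport fun hx' => hx ((hφ n).2.2 hx')]
      simp
    have e2 : ∫ x in Ω, h (‖gradient (φ n) x‖ ^ 2) * ‖gradient (φ n) x‖ ^ 2 =
        ∫ x, h (‖gradient (φ n) x‖ ^ 2) * ‖gradient (φ n) x‖ ^ 2 := by
      refine setIntegral_eq_integral_of_forall_compl_eq_zero fun x hx => ?_
      have : fderiv ℝ (φ n) x = 0 := image_eq_zero_of_notMem_tsupport
        fun hx' => hx ((hφ n).2.2 (tsupport_fderiv_subset ℝ hx'))
      simp [gradient, this]
    rw [e1]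
    rw [e2] at h2
    calc _ ≤ _ := h1
      _ ≤ 32 * R ^ 2 * D 2 * D ((8 * R * D 2) ^ 2) * (2 * D 2 *
          ∫ x in Ω, (∫ v in (0 : ℝ)..(‖gradient (φ n) x‖ ^ 2), h v)) := by gcongr
      _ = _ := by ring
  have hlim' := le_of_tendsto_of_tendsto' t1 (t2.const_mul _) hle
  calc ∫ x in Ω, h (|y x| ^ 2) * |y x| ^ 2
      ≤ 2 * D 2 * ∫ x in Ω, (∫ v in (0 : ℝ)..(‖y x‖ ^ 2), h v) :=
        hh.integral_mul_sq_le hD hy.memLp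
    _ ≤ 2 * D 2 * (64 * R ^ 2 * D 2 ^ 2 * D ((8 * R * D 2) ^ 2) *
        ∫ x in Ω, h (‖g x‖ ^ 2) * ‖g x‖ ^ 2) := by
        gcongr
        exact hlim'.trans (mul_le_mul_of_nonneg_left
          (hh.integral_primitive_le hy.memLp_gradient) (by positivity))
    _ = _ := by ring

end IsDoublingWeight

/-! ### Cut-off functions compared with `min(u, k²)` -/

namespace IsCutoff

variable {k : ℕ} {Φ : ℝ → ℝ}

lemma le_two_mul (hΦ : IsCutoff k Φ) (hk : 1 ≤ k) {u : ℝ} (hu : 0 ≤ u) :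
    Φ u ≤ 2 * min u ((k : ℝ) ^ 2) := by
  have hk1 : (1 : ℝ) ≤ (k : ℝ) ^ 2 := one_le_pow₀ (by exact_mod_cast hk)
  rcases le_or_gt u ((k : ℝ) ^ 2) with h | h
  · rw [hΦ.eq_self u ⟨hu, h⟩, min_eq_left h]; linarith
  · rw [min_eq_right h.le]
    have h1 := hΦ.monotoneOn hu (mem_Ici.2 (by linarith : (0 : ℝ) ≤ u + (k : ℝ) ^ 2 + 2))
      (by linarith)
    rw [hΦ.eq_const (u + (k : ℝ) ^ 2 + 2) (by linarith)] at h1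
    linarith

lemma min_le (hΦ : IsCutoff k Φ) {u : ℝ} (hu : 0 ≤ u) : min u ((k : ℝ) ^ 2) ≤ Φ u := by
  have hk0 : (0 : ℝ) ≤ (k : ℝ) ^ 2 := sq_nonneg _
  have h0 : 0 ≤ min u ((k : ℝ) ^ 2) := le_min hu hk0
  rw [← hΦ.eq_self _ ⟨h0, min_le_right _ _⟩]
  exact hΦ.monotoneOn h0 hu (min_le_left _ _)

lemma nonneg (hΦ : IsCutoff k Φ) {u : ℝ} (hu : 0 ≤ u) : 0 ≤ Φ u :=
  (le_min hu (sq_nonneg _)).trans (hΦ.min_le hu)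

/-- `min(u, k²)` grows at most by the factor `l` under `u ↦ l u`, and `Φ` agrees with it up to a
factor `2`, whatever `k` is. -/
lemma apply_mul_le (hΦ : IsCutoff k Φ) (hk : 1 ≤ k) {l u : ℝ} (hl : 1 ≤ l) (hu : 0 ≤ u) :
    Φ (l * u) ≤ 2 * l * Φ u := by
  have h1 : min (l * u) ((k : ℝ) ^ 2) ≤ l * min u ((k : ℝ) ^ 2) := by
    rw [mul_min_of_nonneg _ _ (zero_le_one.trans hl)]
    exact min_le_min_left _ (le_mul_of_one_le_left (sq_nonneg _) hl)
  have h2 := hΦ.le_two_mul hk (mul_nonneg (zero_le_one.trans hl) hu)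
  have h3 := mul_le_mul_of_nonneg_left (hΦ.min_le hu) (zero_le_one.trans hl)
  linarith

end IsCutoff

/-! ### The regularized weights -/

/-- The weight `[ε + Φ(u)]^{(p-2)/2}` as a function of `u = s²`. -/
noncomputable def cutoffWeight (p ε : ℝ) (Φ : ℝ → ℝ) (u : ℝ) : ℝ :=
  (ε + Φ (max u 0)) ^ ((p - 2) / 2)

/-- The doubling constants of the weights `[ε + Φ(u)]^{(p-2)/2}`. -/
noncomputable def cutoffDoubling (p l : ℝ) : ℝ := (2 * max l 1) ^ ((p - 2) / 2)

section cutoffWeight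

variable {p ε : ℝ} {k : ℕ} {Φ : ℝ → ℝ}

lemma regWeight_eq_cutoffWeight (s : ℝ) : regWeight p ε Φ s = cutoffWeight p ε Φ (s ^ 2) := by
  rw [regWeight, cutoffWeight, max_eq_left (sq_nonneg s)]

lemma one_le_cutoffDoubling (hp : 2 ≤ p) (l : ℝ) : 1 ≤ cutoffDoubling p l :=
  Real.one_le_rpow (by have := le_max_right l 1; linarith) (by linarith)

lemma IsCutoff.isDoublingWeight (hΦ : IsCutoff k Φ) (hk : 1 ≤ k) (hp : 2 ≤ p) (hε : 0 < ε) :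
    IsDoublingWeight (cutoffDoubling p) (cutoffWeight p ε Φ) := by
  have hr : 0 ≤ (p - 2) / 2 := by linarith
  have hpos : ∀ u, 0 < ε + Φ (max u 0) := fun u =>
    add_pos_of_pos_of_nonneg hε (hΦ.nonneg (le_max_right _ _))
  refine ⟨?_, fun u => Real.rpow_nonneg (hpos u).le _, ⟨(ε + 2 * (k : ℝ) ^ 2) ^ ((p - 2) / 2),
    fun u => ?_⟩, fun u hu v hv huv => ?_, fun l u hl hu => ?_⟩
  · have hc : Continuous fun u : ℝ => Φ (max u 0) :=
      hΦ.contDiffOn.continuousOn.comp_continuous (by fun_prop) fun u => le_max_right u 0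
    exact (continuous_const.add hc).rpow_const fun u => Or.inl (hpos u).ne'
  · refine Real.rpow_le_rpow (hpos u).le ?_ hr
    have := hΦ.le_two_mul hk (le_max_right u 0)
    have := min_le_right (max u 0) ((k : ℝ) ^ 2)
    linarith
  · refine Real.rpow_le_rpow (hpos u).le ?_ hr
    rw [max_eq_left hu, max_eq_left hv]
    have := hΦ.monotoneOn hu hv huv
    linarith
  · have hlu : 0 ≤ l * u := mul_nonneg (zero_le_one.trans hl) hu
    rw [cutoffDoubling, cutoffWeight, cutoffWeight, max_eq_left hl, max_eq_left hu,
      max_eq_left hlu, ← Real.mul_rpow (by linarith) (add_nonneg hε.le (hΦ.nonneg hu))]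
    refine Real.rpow_le_rpow (add_nonneg hε.le (hΦ.nonneg hlu)) ?_ hr
    have := hΦ.apply_mul_le hk hl hu
    nlinarith

lemma IsCutoff.rpow_le_cutoffWeight (hΦ : IsCutoff k Φ) (hp : 2 ≤ p) (hε : 0 < ε) (u : ℝ) :
    ε ^ ((p - 2) / 2) ≤ cutoffWeight p ε Φ u :=
  Real.rpow_le_rpow hε.le (by have := hΦ.nonneg (le_max_right u 0); linarith) (by linarith)

lemma IsCutoff.one_le_cutoffWeight (hΦ : IsCutoff k Φ) (hk : 1 ≤ k) (hp : 2 ≤ p) (hε : 0 < ε)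
    {u : ℝ} (hu : 1 ≤ u) : 1 ≤ cutoffWeight p ε Φ u := by
  have hk1 : (1 : ℝ) ≤ (k : ℝ) ^ 2 := one_le_pow₀ (by exact_mod_cast hk)
  refine Real.one_le_rpow ?_ (by linarith)
  have := hΦ.min_le (le_max_right u 0)
  have : 1 ≤ min (max u 0) ((k : ℝ) ^ 2) := le_min (hu.trans (le_max_left _ _)) hk1
  linarith

/-- The growth of the nonlinearity in the dual exponent. -/
lemma IsCutoff.rpow_cutoffWeight_mul_le (hΦ : IsCutoff k Φ) (hk : 1 ≤ k) (hp : 2 ≤ p)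
    (hε : 0 < ε) {a : ℝ} (ha : 0 ≤ a) :
    (cutoffWeight p ε Φ (a ^ 2) * a) ^ (p / (p - 1)) ≤
      1 + 3 ^ ((p - 2) / 2) * ((1 + ε ^ ((p - 2) / 2)) * (cutoffWeight p ε Φ (a ^ 2) * a ^ 2)) := by
  have hr : 0 ≤ (p - 2) / 2 := by linarith
  set w := cutoffWeight p ε Φ (a ^ 2) with hw
  set b := ε ^ ((p - 2) / 2) with hb
  set c : ℝ := 3 ^ ((p - 2) / 2) with hc
  have hb0 : 0 ≤ b := by positivity
  have hc1 : 1 ≤ c := Real.one_le_rpow (by norm_num) hr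
  have hw0 : 0 ≤ w := hb0.trans (hΦ.rpow_le_cutoffWeight hp hε _)
  have hΦ2 := hΦ.le_two_mul hk (sq_nonneg a)
  have hmin := min_le_left (a ^ 2) ((k : ℝ) ^ 2)
  have hΦ0 := hΦ.nonneg (sq_nonneg a)
  have hX : 0 ≤ w * a := by positivity
  have hp1 : 0 < p - 1 := by linarith
  -- If `ε ≤ a²`, then `ε + Φ(a²) ≤ 3a²`, so `w ≤ c a^{p-2}`; writing `q = 1 + 1/(p-1)` gives
  -- `(wa)^q ≤ c w a²`. If `a² < ε`, then `ε + Φ(a²) ≤ 3ε`, so `w ≤ c b`; here `q ≤ 2` gives `(wa)^q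
  -- ≤ 1 + (wa)² ≤ 1 + c b w a²`.
  rcases le_or_gt ε (a ^ 2) with h | h
  · have hwa : w ≤ c * a ^ (p - 2) := by
      have : a ^ (p - 2) = (a ^ 2) ^ ((p - 2) / 2) := by
        rw [← Real.rpow_natCast, ← Real.rpow_mul ha]; congr 1; push_cast; ring
      rw [this, hc, ← Real.mul_rpow (by norm_num) (sq_nonneg a), hw, cutoffWeight,
        max_eq_left (sq_nonneg a)]
      exact Real.rpow_le_rpow (by positivity) (by linarith) hr
    have hwa2 : w * a ≤ c * a ^ (p - 1) := by
      calc w * a ≤ c * a ^ (p - 2) * a := by gcongr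
        _ = c * a ^ (p - 1) := by
          rw [mul_assoc, ← Real.rpow_add_one' ha (by linarith)]; congr 2; ring
    have hroot : (w * a) ^ (1 / (p - 1)) ≤ c * a := by
      calc (w * a) ^ (1 / (p - 1)) ≤ (c * a ^ (p - 1)) ^ (1 / (p - 1)) :=
            Real.rpow_le_rpow hX hwa2 (by positivity)
        _ = c ^ (1 / (p - 1)) * a := by
            rw [Real.mul_rpow (by positivity) (by positivity), ← Real.rpow_mul ha,
              mul_one_div_cancel hp1.ne', Real.rpow_one]
        _ ≤ c * a := by
            gcongr
            refine (Real.rpow_le_rpow_of_exponent_le hc1 ?_).trans_eq (Real.rpow_one c)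
            rw [div_le_one hp1]; linarith
    have hq : p / (p - 1) = 1 + 1 / (p - 1) := by field_simp; ring
    rw [hq, Real.rpow_one_add' hX (by positivity)]
    have h1 : w * a * (w * a) ^ (1 / (p - 1)) ≤ w * a * (c * a) := by gcongr
    have h2 : 0 ≤ c * (b * (w * a ^ 2)) := by positivity
    linarith [mul_comm w c]
  · have hwb : w ≤ c * b := by
      rw [hc, hb, ← Real.mul_rpow (by norm_num) hε.le, hw, cutoffWeight,
        max_eq_left (sq_nonneg a)]
      exact Real.rpow_le_rpow (by positivity) (by linarith) hr
    have hXq : (w * a) ^ (p / (p - 1)) ≤ 1 + (w * a) ^ 2 := by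
      rcases le_or_gt (w * a) 1 with h1 | h1
      · have := Real.rpow_le_one hX h1 (by positivity : 0 ≤ p / (p - 1))
        nlinarith
      · have := Real.rpow_le_rpow_of_exponent_le h1.le
          (show p / (p - 1) ≤ (2 : ℕ) by rw [div_le_iff₀ hp1]; push_cast; linarith)
        rw [Real.rpow_natCast] at this
        linarith
    have h1 : w * (w * a ^ 2) ≤ c * b * (w * a ^ 2) := by gcongr
    have h2 : 0 ≤ c * (w * a ^ 2) := by positivity
    linarith [mul_pow w a 2]

end cutoffWeight

/-! ### Matrix square roots, kernel operators and real inequalities -/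

lemma norm_matVec_sqrt_sq {N : ℕ} {A : Matrix (Fin N) (Fin N) ℝ} (hA : A.IsSymm)
    (hpos : ∀ η : Euc N, 0 ≤ inner ℝ η (matVec A η)) (v : Euc N) :
    ‖matVec (CFC.sqrt A) v‖ ^ 2 = inner ℝ v (matVec A v) := by
  have hA0 : 0 ≤ A := by
    rw [Matrix.nonneg_iff_posSemidef]
    refine Matrix.PosSemidef.of_dotProduct_mulVec_nonneg
      (by rw [Matrix.IsHermitian, Matrix.conjTranspose_eq_transpose_of_trivial]; exact hA)
      fun x => ?_
    have := hpos (WithLp.toLp 2 x)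
    rw [EuclideanSpace.inner_eq_star_dotProduct] at this
    simpa [matVec, dotProduct_comm] using this
  have hs : (CFC.sqrt A).IsHermitian :=
    (Matrix.nonneg_iff_posSemidef.1 (CFC.sqrt_nonneg A)).isHermitian
  have hmul := CFC.sqrt_mul_sqrt_self A hA0
  have hAv : matVec A v = matVec (CFC.sqrt A) (matVec (CFC.sqrt A) v) := by
    simp only [matVec]
    conv_lhs => rw [← hmul]
    simp [Matrix.toEuclideanLin, Matrix.toLpLin]
  rw [hAv, ← real_inner_self_eq_norm_sq]
  exact ((Matrix.isSymmetric_toEuclideanLin_iff.2 hs) v _)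

/-- The integral operator with kernel in `L^p(μ × μ)` maps `L^q` to `L^p`. -/
lemma eLpNorm_integral_kernel_le {X : Type*} [MeasurableSpace X] {μ : Measure X} [SFinite μ]
    {p q : ℝ} (hpq : p.HolderConjugate q) {K : X → X → ℝ} {u : X → ℝ}
    (hK : AEStronglyMeasurable (Function.uncurry K) (μ.prod μ))
    (hu : MemLp u (ENNReal.ofReal q) μ) :
    eLpNorm (fun x => ∫ t, K x t * u t ∂μ) (ENNReal.ofReal p) μ ≤
      eLpNorm (Function.uncurry K) (ENNReal.ofReal p) (μ.prod μ) *
        eLpNorm u (ENNReal.ofReal q) μ := by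
  have hp := hpq.pos
  have hq := hpq.symm.pos
  have e : ∀ {r : ℝ}, 0 < r → ∀ {Y : Type _} [MeasurableSpace Y] (ν : Measure Y) (v : Y → ℝ),
      eLpNorm v (ENNReal.ofReal r) ν = (∫⁻ y, ‖v y‖ₑ ^ r ∂ν) ^ (1 / r) := by
    intro r hr Y _ ν v
    rw [eLpNorm_eq_lintegral_rpow_enorm_toReal (by simpa using hr) ENNReal.ofReal_ne_top,
      ENNReal.toReal_ofReal hr.le]
  have hfin := hu.2.ne
  rw [e hp, e hp, lintegral_prod _ (hK.enorm.pow_const p)]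
  set U := eLpNorm u (ENNReal.ofReal q) μ with hU
  have hsec : ∀ᵐ x ∂μ, AEStronglyMeasurable (K x) μ := hK.prodMk_left
  have hpt : ∀ᵐ x ∂μ, ‖∫ t, K x t * u t ∂μ‖ₑ ^ p ≤ (∫⁻ t, ‖K x t‖ₑ ^ p ∂μ) * U ^ p := by
    filter_upwards [hsec] with x hx
    have h1 : ‖∫ t, K x t * u t ∂μ‖ₑ ≤ (∫⁻ t, ‖K x t‖ₑ ^ p ∂μ) ^ (1 / p) * U := by
      refine (enorm_integral_le_lintegral_enorm _).trans ?_
      simp only [enorm_mul]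
      rw [hU, e hq]
      exact ENNReal.lintegral_mul_le_Lp_mul_Lq μ hpq hx.enorm hu.1.enorm
    refine (ENNReal.rpow_le_rpow h1 hp.le).trans_eq ?_
    rw [ENNReal.mul_rpow_of_nonneg _ _ hp.le, ← ENNReal.rpow_mul, one_div_mul_cancel hp.ne',
      ENNReal.rpow_one]
  calc _ ≤ (∫⁻ x, (∫⁻ t, ‖K x t‖ₑ ^ p ∂μ) * U ^ p ∂μ) ^ (1 / p) := by
        gcongr ?_ ^ (1 / p)
        exact lintegral_mono_ae hpt
    _ = _ := by
        rw [lintegral_mul_const' _ _ (ENNReal.rpow_ne_top_of_nonneg hp.le hfin),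
          ENNReal.mul_rpow_of_nonneg _ _ (by positivity), ← ENNReal.rpow_mul,
          mul_one_div_cancel hp.ne', ENNReal.rpow_one]
        rfl

lemma aestronglyMeasurable_matVec {N : ℕ} {μ : Measure (Euc N)}
    {M : Euc N → Matrix (Fin N) (Fin N) ℝ} {g : Euc N → Euc N}
    (hM : ∀ i j, AEStronglyMeasurable (fun x => M x i j) μ) (hg : AEStronglyMeasurable g μ) :
    AEStronglyMeasurable (fun x => matVec (M x) (g x)) μ := by
  have hMm : AEStronglyMeasurable (fun x => fun i j => M x i j) μ :=
    (aemeasurable_pi_lambda _ fun i => aemeasurable_pi_lambda _ fun j =>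
      (hM i j).aemeasurable).aestronglyMeasurable
  have hc : Continuous fun m : (Fin N → Fin N → ℝ) × Euc N =>
      (WithLp.toLp 2 (fun i => ∑ j, m.1 i j * m.2 j) : Euc N) :=
    (PiLp.continuous_toLp 2 _).comp (by fun_prop)
  exact hc.comp_aestronglyMeasurable (hMm.prodMk hg)

lemma sq_integral_mul_le {X : Type*} [MeasurableSpace X] {μ : Measure X} {f g : X → ℝ}
    (hf : MemLp f 2 μ) (hg : MemLp g 2 μ) :
    (∫ x, f x * g x ∂μ) ^ 2 ≤ (∫ x, f x ^ 2 ∂μ) * ∫ x, g x ^ 2 ∂μ := by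
  have h2 : ENNReal.ofReal 2 = 2 := by simp
  have h := integral_mul_norm_le_Lp_mul_Lq (μ := μ) (f := f) (g := g) Real.HolderConjugate.two_two
    (by rwa [h2]) (by rwa [h2])
  have hf0 : 0 ≤ ∫ x, f x ^ 2 ∂μ := integral_nonneg fun x => sq_nonneg _
  have hg0 : 0 ≤ ∫ x, g x ^ 2 ∂μ := integral_nonneg fun x => sq_nonneg _
  simp only [Real.norm_eq_abs, Real.rpow_two, sq_abs, ← Real.sqrt_eq_rpow] at h
  have h1 : |∫ x, f x * g x ∂μ| ≤ √(∫ x, f x ^ 2 ∂μ) * √(∫ x, g x ^ 2 ∂μ) := by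
    refine (abs_integral_le_integral_abs).trans ?_
    simpa only [abs_mul] using h
  calc _ = |∫ x, f x * g x ∂μ| ^ 2 := (sq_abs _).symm
    _ ≤ (√(∫ x, f x ^ 2 ∂μ) * √(∫ x, g x ^ 2 ∂μ)) ^ 2 := by gcongr
    _ = _ := by rw [mul_pow, Real.sq_sqrt hf0, Real.sq_sqrt hg0]

/-- Two regimes in one: eliminating `S` with `b S ≤ I` gives `b I ≤ κ`, useful for large `b`, and
eliminating it with `S ≤ V + I` gives a quadratic inequality bounding `I` itself, independently of
`b`. It is applied with `b = ε^{(p-2)/2}`, `I` the energy and `S` the integral of `|A^{1/2}∇y|²`. -/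
lemma one_add_mul_le_of_sq_le {I S V b κ : ℝ} (hI : 0 ≤ I) (hV : 0 ≤ V) (hb : 0 ≤ b) (hκ : 0 ≤ κ)
    (h1 : I ^ 2 ≤ κ * S) (h2 : b * S ≤ I) (h3 : S ≤ V + I) :
    (1 + b) * I ≤ 1 + κ * (V + 2) := by
  have hbI : b * I ≤ κ := by
    rcases hI.eq_or_lt with rfl | hI
    · simpa using hκ
    · refine le_of_mul_le_mul_right ?_ hI
      calc b * I * I = b * I ^ 2 := by ring
        _ ≤ b * (κ * S) := by gcongr
        _ = κ * (b * S) := by ring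
        _ ≤ κ * I := by gcongr
  have hI1 : I ≤ 1 + κ * (V + 1) := by
    have hκV : 0 ≤ κ * V := by positivity
    have hIS : I ^ 2 ≤ κ * V + κ * I := by
      calc I ^ 2 ≤ κ * S := h1
        _ ≤ κ * (V + I) := by gcongr
        _ = _ := by ring
    by_contra! hlt
    have hI1 : 1 ≤ I := by nlinarith
    have h5 : I * (1 + κ * (V + 1)) ≤ I * I := by gcongr
    have h6 : κ * V ≤ κ * V * I := le_mul_of_one_le_right hκV hI1
    nlinarith
  linarith

/-! ### The energy estimate for the state equation -/

section Control

variable {N : ℕ} {Ω : Set (Euc N)} {p α γ : ℝ} {ξ₁ ξ₂ : Euc N → ℝ}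
  {A : Euc N → Matrix (Fin N) (Fin N) ℝ}

lemma IsAdmissibleControl.norm_matVec_sqrtField_sq (hA : IsAdmissibleControl Ω ξ₁ ξ₂ γ A) :
    ∀ᵐ x ∂(volume.restrict Ω), ∀ v : Euc N,
      ‖matVec (sqrtField A x) v‖ ^ 2 = inner ℝ v (matVec (A x) v) := by
  filter_upwards [hA.symm, hA.bounds] with x h1 h2 v
  exact norm_matVec_sqrt_sq h1
    (fun η => (mul_nonneg (sq_nonneg _) (sq_nonneg _)).trans (h2 η).1) v

/-- The norm is dominated by `|ξ₂| |g|`; measurability of the root comes from the `BV` condition on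
its entries. -/
lemma IsAdmissibleControl.memLp_matVec_sqrtField (hA : IsAdmissibleControl Ω ξ₁ ξ₂ γ A)
    (hξ₂ : MemLp ξ₂ ⊤ (volume.restrict Ω)) {g : Euc N → Euc N}
    (hg : MemLp g 2 (volume.restrict Ω)) :
    MemLp (fun x => matVec (sqrtField A x) (g x)) 2 (volume.restrict Ω) := by
  have hm : MemLp (ξ₂ • g) 2 (volume.restrict Ω) := hg.smul hξ₂
  refine hm.of_le (aestronglyMeasurable_matVec
    (fun i j => (hA.sqrt_memBV i j).1.aestronglyMeasurable) hg.1) ?_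
  filter_upwards [hA.norm_matVec_sqrtField_sq, hA.bounds] with x h1 h2
  rw [Pi.smul_apply', norm_smul]
  refine (sq_le_sq₀ (norm_nonneg _) (by positivity)).1 ?_
  rw [mul_pow, Real.norm_eq_abs, sq_abs]
  exact (h1 _).trans_le (h2 _).2

lemma IsAdmissibleControl.sq_mul_norm_sq_le (hA : IsAdmissibleControl Ω ξ₁ ξ₂ γ A) (hα : 0 < α)
    (hξ : ∀ᵐ x ∂(volume.restrict Ω), α ≤ ξ₁ x ∧ ξ₁ x ≤ ξ₂ x) (g : Euc N → Euc N) :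
    ∀ᵐ x ∂(volume.restrict Ω), ‖g x‖ ^ 2 ≤ 1 / α ^ 2 * ‖matVec (sqrtField A x) (g x)‖ ^ 2 := by
  filter_upwards [hA.norm_matVec_sqrtField_sq, hA.bounds, hξ] with x h1 h2 h3
  rw [h1, one_div_mul_eq_div, le_div_iff₀ (by positivity), mul_comm]
  refine le_trans ?_ (h2 (g x)).1
  have := h3.1
  gcongr

/-- The energy estimate for the regularized boundary value problem. -/
theorem exists_energy_bound (hN : 1 ≤ N) (hΩb : Bornology.IsBounded Ω) (hp : 2 ≤ p) (hα : 0 < α)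
    (hξ₂ : MemLp ξ₂ ⊤ (volume.restrict Ω))
    (hξ : ∀ᵐ x ∂(volume.restrict Ω), α ≤ ξ₁ x ∧ ξ₁ x ≤ ξ₂ x)
    {f : Euc N → ℝ} (hf : MemLp f 2 (volume.restrict Ω)) :
    ∃ C : ℝ, ∀ (ε : ℝ) (k : ℕ) (Φ : ℝ → ℝ), 0 < ε → 1 ≤ k → IsCutoff k Φ →
      ∀ (A : Euc N → Matrix (Fin N) (Fin N) ℝ) (y : Euc N → ℝ),
        IsAdmissibleControl Ω ξ₁ ξ₂ γ A → IsRegularizedWeakSolution Ω p ε Φ f A y →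
        MemLp y 2 (volume.restrict Ω) ∧
        (1 + ε ^ ((p - 2) / 2)) *
          ∫ x in Ω, cutoffWeight p ε Φ (‖y x‖ ^ 2) * ‖y x‖ ^ 2 ≤ C := by
  obtain ⟨R, hR1, hR⟩ : ∃ R : ℝ, 1 ≤ R ∧ Ω ⊆ Metric.closedBall 0 R := by
    obtain ⟨R, hR⟩ := hΩb.subset_closedBall 0
    exact ⟨max R 1, le_max_right _ _,
      hR.trans (Metric.closedBall_subset_closedBall (le_max_left _ _))⟩
  have hfinite : IsFiniteMeasure (volume.restrict Ω) :=
    isFiniteMeasure_restrict.2 hΩb.measure_lt_top.ne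
  set V : ℝ := (volume.restrict Ω).real univ
  set κ : ℝ := (∫ x in Ω, f x ^ 2) * (128 * R ^ 2 * (1 / α ^ 2)) with hκ
  -- Ellipticity gives `|g|² ≤ α⁻² |s|²`; the maximum with `1` meets the requirement `1 ≤ l` of
  -- doubling.
  set l : ℝ := max 1 (1 / α ^ 2) with hl
  have hl1 : 1 ≤ l := le_max_left _ _
  set D := cutoffDoubling p with hDdef
  have hD : ∀ l, 1 ≤ D l := one_le_cutoffDoubling hp
  have hD2 := hD 2
  have hDR := hD ((8 * R * D 2) ^ 2)
  have hDl := hD l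
  have hf0 : 0 ≤ ∫ x in Ω, f x ^ 2 := integral_nonneg fun x => sq_nonneg _
  refine ⟨128 * R ^ 2 * D 2 ^ 3 * D ((8 * R * D 2) ^ 2) * (D l * l * (1 + κ * (V + 2))), ?_⟩
  intro ε k Φ hε hk hΦ A y hA hy
  obtain ⟨g, hyg, hweak⟩ := hy
  refine ⟨hyg.memLp, ?_⟩
  set i : Fin N := ⟨0, hN⟩
  set h := cutoffWeight p ε Φ with hh_def
  have hh : IsDoublingWeight D h := hΦ.isDoublingWeight hk hp hε
  set b := ε ^ ((p - 2) / 2)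
  have hb : 0 ≤ b := by positivity
  set s : Euc N → Euc N := fun x => matVec (sqrtField A x) (g x) with hs_def
  have hs : MemLp s 2 (volume.restrict Ω) := hA.memLp_matVec_sqrtField hξ₂ hyg.memLp_gradient
  have hgs := hA.sq_mul_norm_sq_le hα hξ g
  have hs2 : Integrable (fun x => ‖s x‖ ^ 2) (volume.restrict Ω) :=
    hs.integrable_norm_pow two_ne_zero
  have hg2 : Integrable (fun x => ‖g x‖ ^ 2) (volume.restrict Ω) :=
    hyg.memLp_gradient.integrable_norm_pow two_ne_zero
  have hIint := hh.integrable_mul_sq hs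
  set I := ∫ x in Ω, h (‖s x‖ ^ 2) * ‖s x‖ ^ 2 with hI
  set S := ∫ x in Ω, ‖s x‖ ^ 2 with hS
  have hI0 : 0 ≤ I := hh.integral_mul_sq_nonneg s
  -- The solution itself is the test function, as `(A g, g) = |A^{1/2} g|²`.
  have htest : I = ∫ x in Ω, f x * y x := by
    rw [← hweak y g hyg]
    refine integral_congr_ae ?_
    filter_upwards [hA.norm_matVec_sqrtField_sq] with x hx
    rw [regWeight_eq_cutoffWeight, real_inner_comm, ← hx]
  have hpoin := IsDoublingWeight.const_one.integral_mul_sq_le_gradient (fun _ => le_rfl) i hR1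
    hR hyg
  simp only [one_mul, sq_abs, one_pow, mul_one] at hpoin
  have hgS : ∫ x in Ω, ‖g x‖ ^ 2 ≤ 1 / α ^ 2 * S := by
    rw [hS, ← integral_const_mul]
    exact integral_mono_ae hg2 (hs2.const_mul _) hgs
  have h1 : I ^ 2 ≤ κ * S := by
    calc I ^ 2 ≤ (∫ x in Ω, f x ^ 2) * ∫ x in Ω, y x ^ 2 := by
          rw [htest]; exact sq_integral_mul_le hf hyg.memLp
      _ ≤ (∫ x in Ω, f x ^ 2) * (128 * R ^ 2 * (1 / α ^ 2 * S)) := by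
          gcongr
          exact hpoin.trans (by gcongr)
      _ = κ * S := by rw [hκ]; ring
  have h2 : b * S ≤ I := by
    rw [hS, ← integral_const_mul]
    exact integral_mono (hs2.const_mul _) hIint fun x =>
      mul_le_mul_of_nonneg_right (hΦ.rpow_le_cutoffWeight hp hε _) (sq_nonneg _)
  -- Pointwise, either `|s|² ≤ 1` or the weight is at least `1`; the latter uses `k ≥ 1`.
  have h3 : S ≤ V + I := by
    have hV : V = ∫ x in Ω, (1 : ℝ) := by simp [V]
    rw [hV, hI, ← integral_add (integrable_const _) hIint]
    refine integral_mono hs2 ((integrable_const _).add hIint) fun x => ?_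
    have h0 := hh.nonneg (‖s x‖ ^ 2)
    rcases le_or_gt (‖s x‖ ^ 2) 1 with hx | hx
    · have : 0 ≤ h (‖s x‖ ^ 2) * ‖s x‖ ^ 2 := by positivity
      simp only; linarith
    · have := mul_le_mul_of_nonneg_right (hΦ.one_le_cutoffWeight hk hp hε hx.le)
        (sq_nonneg ‖s x‖)
      simp only; linarith
  have hV0 : 0 ≤ V := measureReal_nonneg
  have hbound := one_add_mul_le_of_sq_le hI0 hV0 hb (by positivity) h1 h2 h3
  have hgI : ∫ x in Ω, h (‖g x‖ ^ 2) * ‖g x‖ ^ 2 ≤ D l * l * I := by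
    rw [hI, ← integral_const_mul]
    refine integral_mono_ae (hh.integrable_mul_sq hyg.memLp_gradient) (hIint.const_mul _) ?_
    filter_upwards [hgs] with x hx
    have hx' : ‖g x‖ ^ 2 ≤ l * ‖s x‖ ^ 2 := hx.trans (by gcongr; exact le_max_right _ _)
    have hmono : h (‖g x‖ ^ 2) ≤ D l * h (‖s x‖ ^ 2) :=
      (hh.monotoneOn (mem_Ici.2 (sq_nonneg _)) (mem_Ici.2 (by positivity)) hx').trans
        (hh.doubling _ _ hl1 (sq_nonneg _))
    have := hh.nonneg (‖s x‖ ^ 2)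
    calc h (‖g x‖ ^ 2) * ‖g x‖ ^ 2 ≤ D l * h (‖s x‖ ^ 2) * (l * ‖s x‖ ^ 2) := by gcongr
      _ = _ := by ring
  have hy2 := hh.integral_mul_sq_le_gradient hD i hR1 hR hyg
  simp only [← Real.norm_eq_abs] at hy2
  calc (1 + b) * ∫ x in Ω, h (‖y x‖ ^ 2) * ‖y x‖ ^ 2
      ≤ (1 + b) * (128 * R ^ 2 * D 2 ^ 3 * D ((8 * R * D 2) ^ 2) * (D l * l * I)) := by
        gcongr
        exact hy2.trans (by gcongr)
    _ = 128 * R ^ 2 * D 2 ^ 3 * D ((8 * R * D 2) ^ 2) * (D l * l * ((1 + b) * I)) := by ring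
    _ ≤ _ := by gcongr

end Control

/-! ### The Hammerstein equation and the uniform bound -/

namespace IsDoublingWeight

variable {X : Type*} [MeasurableSpace X] {μ : Measure X} {D h : ℝ → ℝ}

lemma memLp_mul (hh : IsDoublingWeight D h) {v : X → ℝ} (hv : MemLp v 2 μ) :
    MemLp (fun x => h (‖v x‖ ^ 2) * v x) 2 μ := by
  obtain ⟨M, hM⟩ := hh.bounded
  refine hv.of_le_mul (c := M)
    ((hh.continuous.comp_aestronglyMeasurable (hv.1.norm.pow 2)).mul hv.1)
    (ae_of_all _ fun x => ?_)
  rw [norm_mul, Real.norm_of_nonneg (hh.nonneg _)]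
  exact mul_le_mul_of_nonneg_right (hM _) (norm_nonneg _)

/-- If `∫ z F ≤ 0` for `F = h(|y|²) y + h(|z|²) z`, then `z` is controlled by `y`. -/
lemma integral_mul_sq_le_of_integral_mul_nonpos (hh : IsDoublingWeight D h) {y z : X → ℝ}
    (hy : MemLp y 2 μ) (hz : MemLp z 2 μ)
    (hle : ∫ x, z x * (h (‖y x‖ ^ 2) * y x + h (‖z x‖ ^ 2) * z x) ∂μ ≤ 0) :
    ∫ x, h (‖z x‖ ^ 2) * ‖z x‖ ^ 2 ∂μ ≤ 4 * ∫ x, h (‖y x‖ ^ 2) * ‖y x‖ ^ 2 ∂μ := by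
  have hzF : Integrable (fun x => z x * (h (‖y x‖ ^ 2) * y x + h (‖z x‖ ^ 2) * z x)) μ :=
    hz.integrable_mul ((hh.memLp_mul hy).add (hh.memLp_mul hz))
  have hiy := hh.integrable_mul_sq hy
  -- Pointwise `h(z²)z² = zF - h(y²)yz ≤ zF + 2h(y²)y² + ½h(z²)z²`; absorbing the last term doubles
  -- the others.
  have hle2 : ∫ x, h (‖z x‖ ^ 2) * ‖z x‖ ^ 2 ∂μ ≤
      2 * ∫ x, z x * (h (‖y x‖ ^ 2) * y x + h (‖z x‖ ^ 2) * z x) ∂μ +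
        4 * ∫ x, h (‖y x‖ ^ 2) * ‖y x‖ ^ 2 ∂μ := by
    rw [← integral_const_mul, ← integral_const_mul,
      ← integral_add (hzF.const_mul _) (hiy.const_mul _)]
    refine integral_mono (hh.integrable_mul_sq hz) ((hzF.const_mul _).add (hiy.const_mul _))
      fun x => ?_
    have h1 := hh.mul_mul_le_half (norm_nonneg (y x)) (norm_nonneg (z x))
    have h2 : -(z x * (h (‖y x‖ ^ 2) * y x)) ≤ h (‖y x‖ ^ 2) * ‖y x‖ * ‖z x‖ := by
      refine (neg_le_abs _).trans_eq ?_
      rw [abs_mul, abs_mul, abs_of_nonneg (hh.nonneg _), Real.norm_eq_abs, Real.norm_eq_abs]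
      ring
    have h3 : z x * (h (‖z x‖ ^ 2) * z x) = h (‖z x‖ ^ 2) * ‖z x‖ ^ 2 := by
      rw [Real.norm_eq_abs, sq_abs]; ring
    simp only
    linarith
  linarith

end IsDoublingWeight

/-- Integrating the pointwise growth bound over a finite measure space gives this; `ε` and `k` enter
only through the modular bound `C`. It serves for both summands of `F`. -/
lemma IsCutoff.eLpNorm_cutoffWeight_mul_le {X : Type*} [MeasurableSpace X] {μ : Measure X}
    [IsFiniteMeasure μ] {p ε C : ℝ} {k : ℕ} {Φ : ℝ → ℝ} (hΦ : IsCutoff k Φ) (hk : 1 ≤ k)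
    (hp : 2 ≤ p) (hε : 0 < ε) {v : X → ℝ} (hv : MemLp v 2 μ)
    (hC : (1 + ε ^ ((p - 2) / 2)) *
      ∫ x, cutoffWeight p ε Φ (‖v x‖ ^ 2) * ‖v x‖ ^ 2 ∂μ ≤ C) :
    eLpNorm (fun x => cutoffWeight p ε Φ (‖v x‖ ^ 2) * v x) (ENNReal.ofReal (p / (p - 1))) μ ≤
      ENNReal.ofReal (μ.real univ + 3 ^ ((p - 2) / 2) * C) ^ (1 / (p / (p - 1))) := by
  have hh := hΦ.isDoublingWeight hk hp hε
  have hp1 : 0 < p - 1 := by linarith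
  have hq : 0 < p / (p - 1) := by positivity
  have hint : Integrable (fun x => 1 + 3 ^ ((p - 2) / 2) * ((1 + ε ^ ((p - 2) / 2)) *
      (cutoffWeight p ε Φ (‖v x‖ ^ 2) * ‖v x‖ ^ 2))) μ :=
    (integrable_const _).add (((hh.integrable_mul_sq hv).const_mul _).const_mul _)
  rw [eLpNorm_eq_lintegral_rpow_enorm_toReal (by simpa using hq) ENNReal.ofReal_ne_top,
    ENNReal.toReal_ofReal hq.le]
  refine ENNReal.rpow_le_rpow ?_ (by positivity)
  calc _ ≤ ∫⁻ x, ENNReal.ofReal (1 + 3 ^ ((p - 2) / 2) * ((1 + ε ^ ((p - 2) / 2)) *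
          (cutoffWeight p ε Φ (‖v x‖ ^ 2) * ‖v x‖ ^ 2))) ∂μ := by
        refine lintegral_mono fun x => ?_
        rw [← ofReal_norm, ENNReal.ofReal_rpow_of_nonneg (norm_nonneg _) hq.le,
          norm_mul, Real.norm_of_nonneg (hh.nonneg _)]
        exact ENNReal.ofReal_le_ofReal
          (hΦ.rpow_cutoffWeight_mul_le hk hp hε (norm_nonneg (v x)))
    _ = ENNReal.ofReal (∫ x, (1 + 3 ^ ((p - 2) / 2) * ((1 + ε ^ ((p - 2) / 2)) *
          (cutoffWeight p ε Φ (‖v x‖ ^ 2) * ‖v x‖ ^ 2))) ∂μ) := by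
        refine (ofReal_integral_eq_lintegral_ofReal hint (ae_of_all _ fun x => ?_)).symm
        have := hh.nonneg (‖v x‖ ^ 2)
        simp only [Pi.zero_apply]
        positivity
    _ ≤ _ := by
        refine ENNReal.ofReal_le_ofReal ?_
        rw [integral_add (integrable_const _)
          (((hh.integrable_mul_sq hv).const_mul _).const_mul _), integral_const_mul,
          integral_const_mul]
        simp only [integral_const, smul_eq_mul, mul_one]
        gcongr

theorem mainTheorem8 (N : ℕ) (hN : 1 ≤ N)
    (Ω : Set (Euc N)) (hΩ : IsOpen Ω) (hΩb : Bornology.IsBounded Ω)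
    (p q : ℝ) (hp : 2 ≤ p) (hq : q = p / (p - 1))
    (α : ℝ) (hα : 0 < α) (γ : ℝ) (hγ : 0 < γ)
    (ξ₁ ξ₂ : Euc N → ℝ)
    (hξ₁ : MemLp ξ₁ ⊤ (volume.restrict Ω)) (hξ₁BV : MemBV Ω ξ₁)
    (hξ₂ : MemLp ξ₂ ⊤ (volume.restrict Ω)) (hξ₂BV : MemBV Ω ξ₂)
    (hξ : ∀ᵐ x ∂(volume.restrict Ω), α ≤ ξ₁ x ∧ ξ₁ x ≤ ξ₂ x)
    (f : Euc N → ℝ) (hf : MemLp f 2 (volume.restrict Ω))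
    (K : Euc N → Euc N → ℝ)
    (hK : MemLp (Function.uncurry K) (ENNReal.ofReal p)
      ((volume.restrict Ω).prod (volume.restrict Ω)))
    (hKpos : ∀ u : Euc N → ℝ, MemLp u (ENNReal.ofReal q) (volume.restrict Ω) →
      0 ≤ ∫ x in Ω, kernelOp Ω K u x * u x)
    (𝓕 : ℕ → ℝ → ℝ) (h𝓕 : ∀ k : ℕ, 1 ≤ k → IsCutoff k (𝓕 k)) :
    ∃ C : ℝ≥0, ∀ (ε : ℝ) (k : ℕ), 0 < ε → 1 ≤ k →
      ∀ (A : Euc N → Matrix (Fin N) (Fin N) ℝ) (y z : Euc N → ℝ),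
        IsAdmissibleTriplet Ω p ξ₁ ξ₂ γ f K ε (𝓕 k) A y z →
          MemLp z (ENNReal.ofReal p) (volume.restrict Ω) ∧
          eLpNorm z (ENNReal.ofReal p) (volume.restrict Ω) ≤ C := by

  obtain ⟨C₀, hC₀⟩ := exists_energy_bound (γ := γ) hN hΩb hp hα hξ₂ hξ hf
  have hfinite : IsFiniteMeasure (volume.restrict Ω) :=
    isFiniteMeasure_restrict.2 hΩb.measure_lt_top.ne
  have hp1 : 0 < p - 1 := by linarith
  have hpq : p.HolderConjugate q := hq ▸ Real.HolderConjugate.conjExponent (by linarith)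
  have hq0 := hpq.symm.pos
  have hq1 : 1 ≤ q := hpq.symm.lt.le
  have hq2 : q ≤ 2 := by rw [hq, div_le_iff₀ hp1]; linarith
  set T : ℝ → ℝ≥0∞ := fun C =>
    ENNReal.ofReal ((volume.restrict Ω).real univ + 3 ^ ((p - 2) / 2) * C) ^ (1 / q) with hT
  have hTfin : ∀ C, T C ≠ ⊤ := fun C =>
    ENNReal.rpow_ne_top_of_nonneg (by positivity) ENNReal.ofReal_ne_top
  set B : ℝ≥0∞ := eLpNorm (Function.uncurry K) (ENNReal.ofReal p)
    ((volume.restrict Ω).prod (volume.restrict Ω)) * (T C₀ + T (4 * C₀)) with hB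
  have hBfin : B ≠ ⊤ :=
    ENNReal.mul_ne_top hK.2.ne (ENNReal.add_ne_top.2 ⟨hTfin _, hTfin _⟩)
  refine ⟨B.toNNReal, fun ε k hε hk A y z htrip => ?_⟩
  rw [ENNReal.coe_toNNReal hBfin]
  have hΦ := h𝓕 k hk
  have hh := hΦ.isDoublingWeight hk hp hε
  obtain ⟨hy, hyC⟩ := hC₀ ε k (𝓕 k) hε hk hΦ A y htrip.control htrip.state
  have hz := htrip.memLp
  set h := cutoffWeight p ε (𝓕 k)
  have hF : hammersteinF p ε (𝓕 k) y z =
      fun x => h (‖y x‖ ^ 2) * y x + h (‖z x‖ ^ 2) * z x := by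
    funext x
    simp only [hammersteinF, regWeight_eq_cutoffWeight, Real.norm_eq_abs, h]
  have hFy := hh.memLp_mul hy
  have hFz := hh.memLp_mul hz
  -- For fixed `ε` and `k` the weight is bounded, so `F` is in `L²`, hence in `L^q` since `q ≤ 2`
  -- and `Ω` has finite measure. This makes `F` admissible in the positivity of `B`.
  have hFq : MemLp (hammersteinF p ε (𝓕 k) y z) (ENNReal.ofReal q) (volume.restrict Ω) := by
    rw [hF]
    refine (hFy.add hFz).mono_exponent ?_
    rw [← ENNReal.ofReal_ofNat 2]
    exact ENNReal.ofReal_le_ofReal hq2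
  have hzeq : ∀ᵐ x ∂(volume.restrict Ω),
      kernelOp Ω K (hammersteinF p ε (𝓕 k) y z) x = -z x := by
    filter_upwards [htrip.hammerstein] with x hx
    linarith
  -- Positivity of `B` is applied to `u = F`, where `BF = -z`.
  have hnonpos : ∫ x in Ω, z x * (h (‖y x‖ ^ 2) * y x + h (‖z x‖ ^ 2) * z x) ≤ 0 := by
    have h1 := hKpos _ hFq
    have h2 : ∫ x in Ω, kernelOp Ω K (hammersteinF p ε (𝓕 k) y z) x *
        hammersteinF p ε (𝓕 k) y z x =
        -∫ x in Ω, z x * (h (‖y x‖ ^ 2) * y x + h (‖z x‖ ^ 2) * z x) := by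
      rw [← integral_neg]
      refine integral_congr_ae ?_
      filter_upwards [hzeq] with x hx
      rw [hx, hF]
      ring
    linarith
  have hzle := hh.integral_mul_sq_le_of_integral_mul_nonpos hy hz hnonpos
  have hzC : (1 + ε ^ ((p - 2) / 2)) * ∫ x in Ω, h (‖z x‖ ^ 2) * ‖z x‖ ^ 2 ≤ 4 * C₀ := by
    have hb : 0 ≤ 1 + ε ^ ((p - 2) / 2) := by positivity
    have := mul_le_mul_of_nonneg_left hzle hb
    linarith
  have hFn : eLpNorm (hammersteinF p ε (𝓕 k) y z) (ENNReal.ofReal q) (volume.restrict Ω) ≤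
      T C₀ + T (4 * C₀) := by
    rw [hF]
    refine (eLpNorm_add_le hFy.1 hFz.1 (by simpa using hq1)).trans ?_
    simp only [hT, hq]
    exact add_le_add (hΦ.eLpNorm_cutoffWeight_mul_le hk hp hε hy hyC)
      (hΦ.eLpNorm_cutoffWeight_mul_le hk hp hε hz hzC)
  have hzB : eLpNorm z (ENNReal.ofReal p) (volume.restrict Ω) ≤ B := by
    have hzn : eLpNorm z (ENNReal.ofReal p) (volume.restrict Ω) =
        eLpNorm (kernelOp Ω K (hammersteinF p ε (𝓕 k) y z)) (ENNReal.ofReal p)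
          (volume.restrict Ω) := by
      rw [← eLpNorm_neg z]
      exact eLpNorm_congr_ae (hzeq.mono fun x hx => hx.symm)
    rw [hzn]
    refine (eLpNorm_integral_kernel_le hpq hK.1 hFq).trans ?_
    rw [hB]
    gcongr
  exact ⟨⟨hz.1, hzB.trans_lt hBfin.lt_top⟩, hzB⟩
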